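/- Let $k$ be a field with algebraic closure $\bar k$, let $\Gamma = \mathrm{Aut}(\bar k/k)$ (the absolute Galois group of $k$), and let $H$ be a commutative affine $k$-group scheme. Let $X(H)$ be the group of characters of $H$, i.e. of morphisms of $\bar k$-group schemes $\chi : H_{\bar k} \to \mathbb{G}_{m,\bar k}$, equivalently of group-like elements of $\mathcal{O}(H_{\bar k}) = \bar k \otimes_k \mathcal{O}(H)$; the group $\Gamma$ acts on $X(H)$ through its action on $\bar k$. For $\chi \in X(H)$, let $k(\chi) \subseteq \bar k$ be its field of definition, i.e. the smallest subextension $K$ of $\bar k/k$ such that $\chi \in K \otimes_k \mathcal{O}(H)$; regard $k(\chi)$ as an $H$-module (a linear representation of $H$ over $k$) on which $H$ acts by multiplication via $\chi$. (i) If $\chi, \chi' \in X(H)$ and $\chi' \notin \Gamma \cdot \chi$, then $\mathrm{Ext}^1_H(k(\chi), k(\chi')) = 0$; that is, every extension of $H$-modules $0 \to k(\chi') \to E \to k(\chi) \to 0$ is equivalent to the split one. (ii) Consequently, the category $H\text{-mod}$ of finite-dimensional $H$-modules has a block decomposition $$H\text{-mod} = \bigoplus_{\chi \in X(H)/\Gamma}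 H\text{-mod}_\chi,$$ where $H\text{-mod}_\chi$ is the full subcategory of $H\text{-mod}$ consisting of the modules all of whose composition factors are isomorphic to $k(\chi)$. Explicitly: each $k(\chi)$ is a simple $H$-module and belongs to $H\text{-mod}_\chi$; the subcategory $H\text{-mod}_\chi$ depends only on the orbit $\Gamma \cdot \chi$; if $\chi' \notin \Gamma \cdot \chi$, then every morphism from an object of $H\text{-mod}_\chi$ to an object of $H\text{-mod}_{\chi'}$ is zero; and every finite-dimensional $H$-module $V$ is in a unique way a direct sum $V = \bigoplus_{o \in X(H)/\Gamma} V_o$ of $H$-stable subspaces such that $V_o$ belongs to $H\text{-mod}_\chi$ for $\chi \in o$. -/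

import Mathlib

open scoped TensorProduct

universe u v w t

noncomputable section

/-! ## Representations of an affine group scheme

An affine group scheme `H` over a field `k` is given by its coordinate ring `A = O(H)`, a
commutative Hopf algebra over `k`; `H` is commutative if and only if `A` is cocommutative. -/

/-- An `H`-module, i.e. a linear representation of the affine group scheme `H` with coordinate
ring `A`: a `k`-vector space `V` with a coaction `V → V ⊗ A` that is coassociative and counital. -/
structure HModule (k : Type u) (A : Type v) [Field k] [CommRing A] [HopfAlgebra k A] where
  carrier : Type w
  [addCommGroup : AddCommGroup carrier]
  [module : Module k carrier]
  coact : carrier →ₗ[k] carrier ⊗[k] A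
  coassoc : (TensorProduct.assoc k carrier A A).toLinearMap ∘ₗ coact.rTensor A ∘ₗ coact =
    (Coalgebra.comul (R := k) (A := A)).lTensor carrier ∘ₗ coact
  counit : (TensorProduct.rid k carrier).toLinearMap ∘ₗ
    (Coalgebra.counit (R := k) (A := A)).lTensor carrier ∘ₗ coact = LinearMap.id

namespace HModule

attribute [instance] HModule.addCommGroup HModule.module

variable {k : Type u} {A : Type v} [Field k] [CommRing A] [HopfAlgebra k A]

instance : CoeSort (HModule.{u, v, w} k A) (Type w) := ⟨HModule.carrier⟩

/-- A linear map between `H`-modules that is `H`-equivariant. -/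
def IsHom (V : HModule.{u, v, w} k A) (W : HModule.{u, v, t} k A) (f : V →ₗ[k] W) : Prop :=
  W.coact ∘ₗ f = f.rTensor A ∘ₗ V.coact

/-- Two `H`-modules are isomorphic. -/
def IsIso (V : HModule.{u, v, w} k A) (W : HModule.{u, v, t} k A) : Prop :=
  ∃ e : V ≃ₗ[k] W, IsHom V W e.toLinearMap

/-- A subspace `W` of an `H`-module `V` is `H`-stable if the coaction sends `W` into `W ⊗ A`. -/
def IsStable (V : HModule.{u, v, w} k A) (W : Submodule k V) : Prop :=
  ∀ x ∈ W, V.coact x ∈ LinearMap.range (W.subtype.rTensor A)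

/-- A simple (irreducible) `H`-module. -/
def IsSimple (V : HModule.{u, v, w} k A) : Prop :=
  Nontrivial V ∧ ∀ W : Submodule k V, V.IsStable W → W = ⊥ ∨ W = ⊤

/-- `S` is a composition factor of `V`: it is a simple subquotient, i.e. simple and a quotient of
an `H`-module that embeds into `V`. -/
def IsCompositionFactor (S V : HModule.{u, v, w} k A) : Prop :=
  S.IsSimple ∧ ∃ (U : HModule.{u, v, w} k A) (i : U →ₗ[k] V) (q : U →ₗ[k] S),
    IsHom U V i ∧ Function.Injective i ∧ IsHom U S q ∧ Function.Surjective q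

lemma rTensor_injective {V W : Type*} [AddCommGroup V] [Module k V] [AddCommGroup W] [Module k W]
    {f : V →ₗ[k] W} (hf : Function.Injective f) (B : Type*) [AddCommGroup B] [Module k B] :
    Function.Injective (f.rTensor B) :=
  Module.Flat.rTensor_preserves_injective_linearMap f hf

/-- The coaction on a stable subspace. -/
def restrictCoact (V : HModule.{u, v, w} k A) (W : Submodule k V) (hW : V.IsStable W) :
    W →ₗ[k] W ⊗[k] A :=
  (LinearEquiv.ofInjective (W.subtype.rTensor A)
      (rTensor_injective W.injective_subtype A)).symm.toLinearMap ∘ₗ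
    (V.coact ∘ₗ W.subtype).codRestrict _ (fun x => hW x x.2)

lemma rTensor_comp_restrictCoact (V : HModule.{u, v, w} k A) (W : Submodule k V)
    (hW : V.IsStable W) :
    W.subtype.rTensor A ∘ₗ V.restrictCoact W hW = V.coact ∘ₗ W.subtype := by
  ext x
  have := LinearEquiv.apply_symm_apply (LinearEquiv.ofInjective (W.subtype.rTensor A)
      (rTensor_injective W.injective_subtype A)) ⟨V.coact x, hW x x.2⟩
  exact congrArg Subtype.val this

/-- A stable subspace as an `H`-module: the unique coaction making the inclusion equivariant. -/
def sub (V : HModule.{u, v, w} k A) (W : Submodule k V) (hW : V.IsStable W) :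
    HModule.{u, v, w} k A where
  carrier := W
  coact := V.restrictCoact W hW
  coassoc := by
    have h := V.rTensor_comp_restrictCoact W hW
    refine LinearMap.cancel_left (f := W.subtype.rTensor (A ⊗[k] A))
      (rTensor_injective W.injective_subtype _) |>.1 ?_
    have e1 : W.subtype.rTensor (A ⊗[k] A) ∘ₗ (TensorProduct.assoc k W A A).toLinearMap =
        (TensorProduct.assoc k V A A).toLinearMap ∘ₗ (W.subtype.rTensor A).rTensor A := by
      ext; rfl
    have e2 : W.subtype.rTensor (A ⊗[k] A) ∘ₗ
        (Coalgebra.comul (R := k) (A := A)).lTensor W =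
        (Coalgebra.comul (R := k) (A := A)).lTensor V ∘ₗ W.subtype.rTensor A := by
      ext; rfl
    rw [← LinearMap.comp_assoc, e1, ← LinearMap.comp_assoc _ _ (W.subtype.rTensor _), e2,
      LinearMap.comp_assoc, LinearMap.comp_assoc, h,
      ← LinearMap.comp_assoc _ (LinearMap.rTensor A (V.restrictCoact W hW)),
      ← LinearMap.rTensor_comp, h, LinearMap.rTensor_comp, LinearMap.comp_assoc, h]
    have := V.coassoc
    simp only [← LinearMap.comp_assoc] at this ⊢
    rw [this]
  counit := by
    have h := V.rTensor_comp_restrictCoact W hW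
    refine LinearMap.cancel_left (f := W.subtype) W.injective_subtype |>.1 ?_
    have e1 : W.subtype ∘ₗ (TensorProduct.rid k W).toLinearMap ∘ₗ
          (Coalgebra.counit (R := k) (A := A)).lTensor W =
        (TensorProduct.rid k V).toLinearMap ∘ₗ
          (Coalgebra.counit (R := k) (A := A)).lTensor V ∘ₗ W.subtype.rTensor A := by
      ext; simp
    have := V.counit
    simp only [← LinearMap.comp_assoc] at this e1 ⊢
    rw [e1, LinearMap.comp_assoc, h, ← LinearMap.comp_assoc, this, LinearMap.id_comp,
      LinearMap.comp_id]

/-- The direct sum of two `H`-modules. -/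
def prod (V W : HModule.{u, v, w} k A) : HModule.{u, v, w} k A where
  carrier := V × W
  coact := LinearMap.coprod ((LinearMap.inl k V W).rTensor A ∘ₗ V.coact)
    ((LinearMap.inr k V W).rTensor A ∘ₗ W.coact)
  coassoc := by
    have key : ∀ (X : HModule.{u, v, w} k A) (f : X →ₗ[k] V × W) (c : V × W →ₗ[k] (V × W) ⊗[k] A),
        c ∘ₗ f = f.rTensor A ∘ₗ X.coact →
        ((TensorProduct.assoc k (V × W) A A).toLinearMap ∘ₗ c.rTensor A ∘ₗ c) ∘ₗ f =
          ((Coalgebra.comul (R := k) (A := A)).lTensor (V × W) ∘ₗ c) ∘ₗ f := by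
      intro X f c h
      have e1 : f.rTensor (A ⊗[k] A) ∘ₗ (TensorProduct.assoc k X A A).toLinearMap =
          (TensorProduct.assoc k (V × W) A A).toLinearMap ∘ₗ (f.rTensor A).rTensor A := by
        ext; rfl
      have e2 : f.rTensor (A ⊗[k] A) ∘ₗ (Coalgebra.comul (R := k) (A := A)).lTensor X =
          (Coalgebra.comul (R := k) (A := A)).lTensor (V × W) ∘ₗ f.rTensor A := by
        ext; rfl
      have hc := congrArg (LinearMap.comp (f.rTensor (A ⊗[k] A))) X.coassoc
      rw [← LinearMap.comp_assoc, e1, ← LinearMap.comp_assoc X.coact _ (f.rTensor _), e2,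
        LinearMap.comp_assoc, LinearMap.comp_assoc, ← h,
        ← LinearMap.comp_assoc _ (X.coact.rTensor A), ← LinearMap.rTensor_comp, ← h,
        LinearMap.rTensor_comp, LinearMap.comp_assoc, ← h] at hc
      simpa only [LinearMap.comp_assoc] using hc
    refine LinearMap.prod_ext ?_ ?_
    · exact key V _ _ (LinearMap.coprod_inl _ _)
    · exact key W _ _ (LinearMap.coprod_inr _ _)
  counit := by
    have key : ∀ (X : HModule.{u, v, w} k A) (f : X →ₗ[k] V × W) (c : V × W →ₗ[k] (V × W) ⊗[k] A),
        c ∘ₗ f = f.rTensor A ∘ₗ X.coact →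
        ((TensorProduct.rid k (V × W)).toLinearMap ∘ₗ
          (Coalgebra.counit (R := k) (A := A)).lTensor (V × W) ∘ₗ c) ∘ₗ f =
          LinearMap.id ∘ₗ f := by
      intro X f c h
      have e1 : f ∘ₗ (TensorProduct.rid k X).toLinearMap ∘ₗ
            (Coalgebra.counit (R := k) (A := A)).lTensor X =
          (TensorProduct.rid k (V × W)).toLinearMap ∘ₗ
            (Coalgebra.counit (R := k) (A := A)).lTensor (V × W) ∘ₗ f.rTensor A := by
        ext <;> simp
      have hc := congrArg (LinearMap.comp f) X.counit
      simp only [← LinearMap.comp_assoc] at e1 hc ⊢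
      rw [e1, LinearMap.comp_assoc, ← h, LinearMap.comp_id] at hc
      simpa only [LinearMap.comp_assoc, LinearMap.id_comp] using hc
    refine LinearMap.prod_ext ?_ ?_
    · exact key V _ _ (LinearMap.coprod_inl _ _)
    · exact key W _ _ (LinearMap.coprod_inr _ _)

/-- A short exact sequence `0 → N → E → M → 0` of `H`-modules. -/
structure Extension (M N : HModule.{u, v, w} k A) where
  E : HModule.{u, v, w} k A
  i : N →ₗ[k] E
  p : E →ₗ[k] M
  isHom_i : IsHom N E i
  isHom_p : IsHom E M p
  injective_i : Function.Injective i
  exact : Function.Exact i p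
  surjective_p : Function.Surjective p

/-- The split extension `0 → N → M ⊕ N → M → 0`. -/
def Extension.split (M N : HModule.{u, v, w} k A) : Extension M N where
  E := M.prod N
  i := LinearMap.inr k M N
  p := LinearMap.fst k M N
  isHom_i := LinearMap.coprod_inr _ _
  isHom_p := by
    refine LinearMap.prod_ext ?_ ?_
    · change M.coact ∘ₗ LinearMap.fst k M N ∘ₗ LinearMap.inl k M N =
        (LinearMap.fst k M N).rTensor A ∘ₗ (LinearMap.coprod _ _ ∘ₗ LinearMap.inl k M N)
      rw [LinearMap.coprod_inl, ← LinearMap.comp_assoc _ _ (LinearMap.rTensor A _), ← LinearMap.rTensor_comp,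
        LinearMap.fst_comp_inl, LinearMap.rTensor_id, LinearMap.id_comp, LinearMap.comp_id]
    · change M.coact ∘ₗ LinearMap.fst k M N ∘ₗ LinearMap.inr k M N =
        (LinearMap.fst k M N).rTensor A ∘ₗ (LinearMap.coprod _ _ ∘ₗ LinearMap.inr k M N)
      rw [LinearMap.coprod_inr, ← LinearMap.comp_assoc _ _ (LinearMap.rTensor A _), ← LinearMap.rTensor_comp,
        LinearMap.fst_comp_inr, LinearMap.rTensor_zero, LinearMap.zero_comp, LinearMap.comp_zero]
  injective_i := LinearMap.inr_injective
  exact := Function.Exact.inr_fst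
  surjective_p := LinearMap.fst_surjective

/-- Equivalence of extensions: a morphism inducing the identity on `N` and on `M`.
Such a morphism is automatically an isomorphism. -/
def Extension.Rel {M N : HModule.{u, v, w} k A} (X Y : Extension M N) : Prop :=
  ∃ f : X.E →ₗ[k] Y.E, IsHom X.E Y.E f ∧ f ∘ₗ X.i = Y.i ∧ Y.p ∘ₗ f = X.p

/-- The Yoneda group `Ext¹_H(M, N)` (as a pointed set): equivalence classes of extensions
`0 → N → E → M → 0` of `H`-modules, with the class of the split extension as zero element. -/
def Ext1 (M N : HModule.{u, v, w} k A) : Type _ := Quot (Extension.Rel (M := M) (N := N))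

instance (M N : HModule.{u, v, w} k A) : Zero (Ext1 M N) := ⟨Quot.mk _ (Extension.split M N)⟩

end HModule

/-! ## Characters -/

/-- A character of `H`: a morphism of group schemes `H_{kbar} → 𝔾ₘ` over `kbar`, viewed as a
group-like element of the coordinate ring `kbar ⊗ A` of `H_{kbar}`
(compare `HCharacter.equivBialgHom`). -/
abbrev HCharacter (k : Type u) (A : Type v) (kbar : Type w) [Field k] [CommRing A]
    [HopfAlgebra k A] [Field kbar] [Algebra k kbar] : Type (max v w) :=
  GroupLike kbar (kbar ⊗[k] A)

namespace HCharacter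

variable {k : Type u} {A : Type v} {kbar : Type w} [Field k] [CommRing A] [HopfAlgebra k A]
  [Field kbar] [Algebra k kbar]

/-- The algebra homomorphism `kbar[T, T⁻¹] → O(H_{kbar})` with `T ↦ χ`. -/
def liftHom (χ : HCharacter k A kbar) : LaurentPolynomial kbar →ₐ[kbar] kbar ⊗[k] A :=
  AddMonoidAlgebra.lift kbar (kbar ⊗[k] A) ℤ
    ((Units.coeHom _).comp (zpowersHom _ (GroupLike.toUnits kbar χ)))

lemma liftHom_T (χ : HCharacter k A kbar) : liftHom χ (LaurentPolynomial.T 1) = χ.val := by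
  unfold liftHom LaurentPolynomial.T
  rw [AddMonoidAlgebra.lift_single]
  simp

/-- Group-like elements of `O(H_{kbar})` are the same as homomorphisms of Hopf algebras from
`O(𝔾ₘ) = kbar[T, T⁻¹]` to `O(H_{kbar})`, i.e. as morphisms of group schemes `H_{kbar} → 𝔾ₘ`. -/
def equivBialgHom : HCharacter k A kbar ≃
    (LaurentPolynomial kbar →ₐc[kbar] kbar ⊗[k] A) where
  toFun χ := BialgHom.ofAlgHom (liftHom χ)
    (by
      refine AddMonoidAlgebra.algHom_ext' (MonoidHom.ext_mint ?_) (by ext)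
      have := χ.2.counit_eq_one
      simp_all [liftHom_T])
    (by
      refine AddMonoidAlgebra.algHom_ext' (MonoidHom.ext_mint ?_) (by ext)
      have := χ.2.comul_eq_tmul_self
      simp_all [liftHom_T])
  invFun φ := ⟨φ (LaurentPolynomial.T 1),
    IsGroupLikeElem.map φ (AddMonoidAlgebra.isGroupLikeElem_of (R := kbar) (A := kbar) (1 : ℤ))⟩
  left_inv χ := by
    ext
    exact liftHom_T χ
  right_inv φ := by
    refine AddMonoidAlgebra.bialgHom_ext' (MonoidHom.ext_mint ?_) (by ext)
    exact liftHom_T _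

/-! For a `k`-algebra `R`, the maps `R ⊗ A → R ⊗ (A ⊗ A)` induced by the comultiplication and by
the two inclusions `A → A ⊗ A`. -/

section Coface

variable (k A) (R : Type*) [CommRing R] [Algebra k R]

def d0 : R ⊗[k] A →ₐ[R] R ⊗[k] (A ⊗[k] A) :=
  Algebra.TensorProduct.map (AlgHom.id R R) (Bialgebra.comulAlgHom k A)

def d1 : R ⊗[k] A →ₐ[R] R ⊗[k] (A ⊗[k] A) :=
  Algebra.TensorProduct.map (AlgHom.id R R) Algebra.TensorProduct.includeLeft

def d2 : R ⊗[k] A →ₐ[R] R ⊗[k] (A ⊗[k] A) :=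
  Algebra.TensorProduct.map (AlgHom.id R R) Algebra.TensorProduct.includeRight

/-- The base change of the counit. -/
def ev : R ⊗[k] A →ₐ[R] R :=
  (Algebra.TensorProduct.rid k R R).toAlgHom.comp
    (Algebra.TensorProduct.map (AlgHom.id R R) (Bialgebra.counitAlgHom k A))

variable {k A R} {R' : Type*} [CommRing R'] [Algebra k R']

/-- The change of coefficients `R ⊗ B → R' ⊗ B`. -/
abbrev bc (f : R →ₐ[k] R') (B : Type*) [CommRing B] [Algebra k B] : R ⊗[k] B →ₐ[k] R' ⊗[k] B :=
  Algebra.TensorProduct.map f (AlgHom.id k B)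

lemma d0_bc (f : R →ₐ[k] R') (z : R ⊗[k] A) :
    d0 k A R' (bc f A z) = bc f (A ⊗[k] A) (d0 k A R z) := by
  induction z with
  | zero => simp
  | tmul x a => simp [d0]
  | add x y hx hy => simp only [map_add, hx, hy]

lemma d1_bc (f : R →ₐ[k] R') (z : R ⊗[k] A) :
    d1 k A R' (bc f A z) = bc f (A ⊗[k] A) (d1 k A R z) := by
  induction z with
  | zero => simp
  | tmul x a => simp [d1]
  | add x y hx hy => simp only [map_add, hx, hy]

lemma d2_bc (f : R →ₐ[k] R') (z : R ⊗[k] A) :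
    d2 k A R' (bc f A z) = bc f (A ⊗[k] A) (d2 k A R z) := by
  induction z with
  | zero => simp
  | tmul x a => simp [d2]
  | add x y hx hy => simp only [map_add, hx, hy]

lemma ev_bc (f : R →ₐ[k] R') (z : R ⊗[k] A) : ev k A R' (bc f A z) = f (ev k A R z) := by
  induction z with
  | zero => simp
  | tmul x a => simp [ev]
  | add x y hx hy => simp only [map_add, hx, hy]

lemma isGroupLikeElem_iff_coface (z : R ⊗[k] A) :
    IsGroupLikeElem R z ↔ ev k A R z = 1 ∧ d0 k A R z = d1 k A R z * d2 k A R z := by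
  let Ψ := TensorProduct.AlgebraTensorModule.distribBaseChange k R A A
  have h1 : ∀ z : R ⊗[k] A, Coalgebra.counit (R := R) z = ev k A R z := by
    intro z
    induction z with
    | zero => simp
    | tmul x a => simp [ev]
    | add x y hx hy => simp only [map_add, hx, hy]
  have h2 : ∀ z : R ⊗[k] A, Coalgebra.comul (R := R) z = Ψ (d0 k A R z) := by
    intro z
    induction z with
    | zero => simp
    | tmul x a =>
      simp only [TensorProduct.comul_tmul, CommSemiring.comul_apply, d0,
        Algebra.TensorProduct.map_tmul, AlgHom.coe_id, id_eq, Bialgebra.comulAlgHom_apply]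
      induction Coalgebra.comul (R := k) a with
      | zero => simp
      | tmul b c =>
        have e1 : x ⊗ₜ[k] c = x • ((1 : R) ⊗ₜ[k] c) := by simp [TensorProduct.smul_tmul']
        have e2 : x ⊗ₜ[k] b = x • ((1 : R) ⊗ₜ[k] b) := by simp [TensorProduct.smul_tmul']
        simp only [Ψ, TensorProduct.AlgebraTensorModule.distribBaseChange_tmul,
          TensorProduct.AlgebraTensorModule.tensorTensorTensorComm_tmul]
        rw [e1, e2, TensorProduct.smul_tmul]
      | add x y hx hy => simp only [TensorProduct.tmul_add, map_add, hx, hy]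
    | add x y hx hy => simp only [map_add, hx, hy]
  have h3 : ∀ z w : R ⊗[k] A, Ψ (d1 k A R z * d2 k A R w) = z ⊗ₜ[R] w := by
    intro z w
    induction z with
    | zero => simp
    | tmul x a =>
      induction w with
      | zero => simp
      | tmul y b =>
        have e1 : y ⊗ₜ[k] b = y • ((1 : R) ⊗ₜ[k] b) := by simp [TensorProduct.smul_tmul']
        have e2 : (x * y) ⊗ₜ[k] a = y • (x ⊗ₜ[k] a) := by
          simp [TensorProduct.smul_tmul', mul_comm]
        simp [d1, d2, Ψ]
        rw [e1, e2, TensorProduct.tmul_smul, ← TensorProduct.smul_tmul']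
      | add x y hx hy => simp only [map_add, mul_add, TensorProduct.tmul_add, hx, hy]
    | add x y hx hy => simp only [map_add, add_mul, TensorProduct.add_tmul, hx, hy]
  rw [isGroupLikeElem_iff, h1, h2, ← h3, Ψ.injective.eq_iff]

end Coface

/-- The action of `Aut(kbar/k)` on the characters, through its action on `kbar` in `kbar ⊗ A`. -/
instance : MulAction Gal(kbar/k) (HCharacter k A kbar) where
  smul γ χ := ⟨bc γ.toAlgHom A χ.val, by
    obtain ⟨h1, h2⟩ := (isGroupLikeElem_iff_coface _).1 χ.2
    rw [isGroupLikeElem_iff_coface, ev_bc, d0_bc, d1_bc, d2_bc, h1, h2]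
    simp⟩
  one_smul χ := by
    ext
    change bc (AlgHom.id k kbar) A χ.val = χ.val
    simp [bc]
  mul_smul γ δ χ := by
    ext
    change bc _ A χ.val = bc _ A (bc _ A χ.val)
    rw [← AlgHom.comp_apply, ← Algebra.TensorProduct.map_comp]
    rfl

lemma smul_val (γ : Gal(kbar/k)) (χ : HCharacter k A kbar) :
    (γ • χ).val = Algebra.TensorProduct.map γ.toAlgHom (AlgHom.id k A) χ.val := rfl

/-- `χ` is defined over the subextension `K` of `kbar / k` if it lies in `K ⊗ A ⊆ kbar ⊗ A`. -/
def IsDefinedOver (χ : HCharacter k A kbar) (K : IntermediateField k kbar) : Prop :=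
  χ.val ∈ Set.range (Algebra.TensorProduct.map K.val (AlgHom.id k A))

/-- The field of definition `k(χ)`: the smallest subextension of `kbar / k` over which `χ` is
defined. -/
def fieldOfDef (χ : HCharacter k A kbar) : IntermediateField k kbar :=
  sInf {K | χ.IsDefinedOver K}

theorem isDefinedOver_fieldOfDef (χ : HCharacter k A kbar) : χ.IsDefinedOver χ.fieldOfDef := by
  let b := Module.Free.chooseBasis k A
  have hc : ∀ j, (b.baseChange kbar).repr χ.val j ∈ χ.fieldOfDef := by
    intro j
    rw [fieldOfDef, IntermediateField.mem_sInf]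
    rintro K ⟨x, hx⟩
    have : ∀ x : K ⊗[k] A, (b.baseChange kbar).repr
        (Algebra.TensorProduct.map K.val (AlgHom.id k A) x) j ∈ K := by
      intro x
      induction x with
      | zero => simp
      | tmul y a =>
        have := K.mul_mem (K.algebraMap_mem (b.repr a j)) y.2
        simpa [Algebra.smul_def] using this
      | add y z hy hz =>
        simp only [map_add, Finsupp.add_apply]
        exact add_mem hy hz
    exact hx ▸ this x
  refine ⟨∑ j ∈ ((b.baseChange kbar).repr χ.val).support, (⟨_, hc j⟩ : χ.fieldOfDef) ⊗ₜ b j, ?_⟩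
  conv_rhs => rw [← (b.baseChange kbar).linearCombination_repr χ.val]
  rw [Finsupp.linearCombination_apply, Finsupp.sum, map_sum]
  refine Finset.sum_congr rfl fun j _ => ?_
  simp [TensorProduct.smul_tmul']

/-- `χ` as an element of `k(χ) ⊗ A`. -/
def descent (χ : HCharacter k A kbar) : χ.fieldOfDef ⊗[k] A := χ.isDefinedOver_fieldOfDef.choose

lemma bc_descent (χ : HCharacter k A kbar) :
    Algebra.TensorProduct.map χ.fieldOfDef.val (AlgHom.id k A) χ.descent = χ.val :=
  χ.isDefinedOver_fieldOfDef.choose_spec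

lemma bc_injective (K : IntermediateField k kbar) (B : Type*) [CommRing B] [Algebra k B] :
    Function.Injective (bc K.val B) :=
  HModule.rTensor_injective (f := K.val.toLinearMap) K.val.injective B

lemma isGroupLikeElem_descent (χ : HCharacter k A kbar) :
    IsGroupLikeElem χ.fieldOfDef χ.descent := by
  obtain ⟨h1, h2⟩ := (isGroupLikeElem_iff_coface _).1 χ.2
  rw [← bc_descent] at h1 h2
  rw [isGroupLikeElem_iff_coface]
  constructor
  · refine χ.fieldOfDef.val.injective (?_ : χ.fieldOfDef.val _ = χ.fieldOfDef.val _)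
    rw [← ev_bc, map_one]
    exact h1
  · apply bc_injective χ.fieldOfDef
    rw [map_mul, ← d0_bc, ← d1_bc, ← d2_bc]
    exact h2

/-- The `H`-module `k(χ)`: the `k`-vector space `k(χ)` on which `H` acts by multiplication through
`χ`, i.e. with coaction `x ↦ (x ⊗ 1) * χ`. -/
def toHModule (χ : HCharacter k A kbar) : HModule.{u, v, w} k A where
  carrier := χ.fieldOfDef
  coact := LinearMap.mulRight k χ.descent ∘ₗ
    (Algebra.TensorProduct.includeLeft : χ.fieldOfDef →ₐ[k] χ.fieldOfDef ⊗[k] A).toLinearMap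
  coassoc := by
    obtain ⟨-, h⟩ := (isGroupLikeElem_iff_coface _).1 χ.isGroupLikeElem_descent
    have e1 : ∀ z : χ.fieldOfDef ⊗[k] A,
        TensorProduct.assoc k χ.fieldOfDef A A
          ((LinearMap.mulRight k χ.descent ∘ₗ (Algebra.TensorProduct.includeLeft :
            χ.fieldOfDef →ₐ[k] χ.fieldOfDef ⊗[k] A).toLinearMap).rTensor A z) =
        d1 k A _ χ.descent * d2 k A _ z := by
      intro z
      have e2 : ∀ (y : χ.fieldOfDef ⊗[k] A) (a : A),
          TensorProduct.assoc k χ.fieldOfDef A A (y ⊗ₜ a) = d1 k A _ y * d2 k A _ (1 ⊗ₜ a) := by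
        intro y a
        induction y with
        | zero => simp
        | tmul y b => simp [d1, d2]
        | add x y hx hy => simp only [TensorProduct.add_tmul, map_add, add_mul, hx, hy]
      induction z with
      | zero => simp
      | tmul x a =>
        rw [LinearMap.rTensor_tmul, e2]
        simp only [LinearMap.comp_apply, AlgHom.toLinearMap_apply, LinearMap.mulRight_apply,
          Algebra.TensorProduct.includeLeft_apply, map_mul]
        have e4 : d2 k A χ.fieldOfDef (x ⊗ₜ a) =
            d1 k A χ.fieldOfDef (x ⊗ₜ 1) * d2 k A χ.fieldOfDef (1 ⊗ₜ a) := by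
          simp [d1, d2]
        rw [e4]
        ring
      | add x y hx hy => simp only [map_add, mul_add, hx, hy]
    have e3 : ∀ z : χ.fieldOfDef ⊗[k] A,
        (Coalgebra.comul (R := k) (A := A)).lTensor χ.fieldOfDef z = d0 k A _ z := by
      intro z
      induction z with
      | zero => simp
      | tmul x a => simp [d0]
      | add x y hx hy => simp only [map_add, hx, hy]
    ext x
    simp only [LinearMap.comp_apply, LinearEquiv.coe_coe]
    erw [e1, e3]
    simp only [AlgHom.toLinearMap_apply, LinearMap.mulRight_apply,
          Algebra.TensorProduct.includeLeft_apply, map_mul, h]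
    simp only [d0, d2, Algebra.TensorProduct.map_tmul, map_one, Algebra.TensorProduct.one_def]
    ring
  counit := by
    obtain ⟨h, -⟩ := (isGroupLikeElem_iff_coface _).1 χ.isGroupLikeElem_descent
    have e3 : ∀ z : χ.fieldOfDef ⊗[k] A, TensorProduct.rid k χ.fieldOfDef
        ((Coalgebra.counit (R := k) (A := A)).lTensor χ.fieldOfDef z) = ev k A _ z := by
      intro z
      induction z with
      | zero => simp
      | tmul x a => simp [ev]
      | add x y hx hy => simp only [map_add, hx, hy]
    ext x
    simp only [LinearMap.comp_apply, LinearEquiv.coe_coe]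
    erw [e3]
    simp [h]
    simp [ev]

end HCharacter

namespace HModule

variable {k : Type u} {A : Type v} {kbar : Type w} [Field k] [CommRing A] [HopfAlgebra k A]
  [Field kbar] [Algebra k kbar]

/-- `V` belongs to the full subcategory `H-mod_χ` of the category `H-mod` of finite-dimensional
`H`-modules: all composition factors of `V` are isomorphic to `k(χ)`. -/
def InBlock (V : HModule.{u, v, t} k A) (χ : HCharacter k A kbar) : Prop :=
  Module.Finite k V ∧
    ∀ S : HModule.{u, v, t} k A, S.IsCompositionFactor V → S.IsIso χ.toHModule

open Classical in
/-- A family of `H`-stable subspaces `W o` of `V`, indexed by the Galois orbits `o` of characters,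
is a block decomposition if `V = ⨁ o, W o` and `W o` belongs to `H-mod_χ` for `χ ∈ o`. -/
def IsBlockDecomposition (V : HModule.{u, v, t} k A)
    (W : MulAction.orbitRel.Quotient Gal(kbar/k) (HCharacter k A kbar) →
      {W : Submodule k V // V.IsStable W}) : Prop :=
  DirectSum.IsInternal (fun o => (W o).1) ∧
    ∀ χ : HCharacter k A kbar,
      (V.sub (W (Quotient.mk _ χ)).1 (W (Quotient.mk _ χ)).2).InBlock χ

end HModule

end

/-! The linear dual `ConvDual k A` of `A` is an algebra under convolution, commutative because `A`
is cocommutative, and a coaction on `V` is a special kind of module structure over it: `r` acts by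
`V → V ⊗ A → V`. Equivariant maps, stable subspaces and simple modules become linear maps,
submodules and simple modules over this ring (`isHom_iff`, `isStable_iff`, `isSimple_iff`), so the
theorem is commutative algebra over the dual.

A character is an algebra homomorphism from the dual to `kbar` (`evalHom`). Its image is exactly
`k(χ)`, so the module `k(χ)` is the quotient of the dual by a maximal ideal `χ.maximal`. Two
characters have the same maximal ideal if and only if they are Galois conjugate, because an
embedding of `k(χ)` into `kbar` extends to an automorphism (`maximal_eq_iff`). Conversely, every
finite-dimensional simple module has some `χ.maximal` as annihilator
(`exists_annihilator_eq_maximal`).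

For non-conjugate characters the annihilators are distinct maximal ideals, hence coprime, and
extensions split (`Extension.rel_split_of_isCoprime`). A finite-dimensional module over a
commutative algebra is the direct sum of its primary components; the block of `χ` consists of the
modules primary for `χ.maximal` (`inBlock_iff`), and the block decomposition is the primary
decomposition. -/

noncomputable section

/-! ### Contraction of tensors with linear forms. -/

section Contract

variable {k : Type*} [Field k] {A : Type*} [AddCommGroup A] [Module k A]

/-- Contraction of `M ⊗ A` with a linear form on `A`. -/
def contract (M : Type*) [AddCommGroup M] [Module k M] (f : A →ₗ[k] k) : M ⊗[k] A →ₗ[k] M :=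
  (TensorProduct.rid k M).toLinearMap ∘ₗ f.lTensor M

variable {M N : Type*} [AddCommGroup M] [Module k M] [AddCommGroup N] [Module k N]

@[simp]
lemma contract_tmul (f : A →ₗ[k] k) (m : M) (a : A) : contract M f (m ⊗ₜ a) = f a • m := by
  simp [contract]

lemma contract_rTensor (f : A →ₗ[k] k) (g : M →ₗ[k] N) (z : M ⊗[k] A) :
    contract N f (g.rTensor A z) = g (contract M f z) := by
  induction z with
  | zero => simp
  | tmul x a => simp
  | add x y hx hy => simp only [map_add, hx, hy]

lemma contract_lTensor {B : Type*} [AddCommGroup B] [Module k B] (f : B →ₗ[k] k) (g : A →ₗ[k] B)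
    (z : M ⊗[k] A) : contract M f (g.lTensor M z) = contract M (f ∘ₗ g) z := by
  induction z with
  | zero => simp
  | tmul x a => simp
  | add x y hx hy => simp only [map_add, hx, hy]

lemma contract_contract {B : Type*} [AddCommGroup B] [Module k B] (f : A →ₗ[k] k) (g : B →ₗ[k] k)
    (z : (M ⊗[k] A) ⊗[k] B) :
    contract M f (contract (M ⊗[k] A) g z) =
      contract M (LinearMap.mul' k k ∘ₗ TensorProduct.map f g)
        (TensorProduct.assoc k M A B z) := by
  induction z with
  | zero => simp
  | tmul y b =>
    induction y with
    | zero => simp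
    | tmul x a => simp [smul_smul, mul_comm]
    | add x y hx hy => simp only [TensorProduct.add_tmul, map_add, hx, hy]
  | add x y hx hy => simp only [map_add, hx, hy]

/-- Expansion in a basis of the second factor: the coefficients are contractions with the coordinate
forms, and only finitely many are nonzero. -/
lemma sum_contract_coord {ι : Type*} (b : Module.Basis ι k A) (z : M ⊗[k] A) :
    ∃ s : Finset ι, z = ∑ i ∈ s, contract M (b.coord i) z ⊗ₜ b i := by
  classical
  refine ⟨(TensorProduct.equivFinsuppOfBasisRight b z).support, ?_⟩
  have h := (TensorProduct.equivFinsuppOfBasisRight (M := M) b).symm_apply_apply z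
  rw [TensorProduct.equivFinsuppOfBasisRight_symm_apply, Finsupp.sum] at h
  simpa [TensorProduct.equivFinsuppOfBasisRight_apply, contract] using h.symm

lemma eq_of_contract_eq {z w : M ⊗[k] A} (h : ∀ f : A →ₗ[k] k, contract M f z = contract M f w) :
    z = w := by
  obtain ⟨s, hs⟩ := sum_contract_coord (Module.Free.chooseBasis k A) (z - w)
  rw [← sub_eq_zero, hs]
  exact Finset.sum_eq_zero fun i _ => by simp [h]

/-- Linear forms `f ⊗ g` separate the elements of `M ⊗ (A ⊗ B)`. -/
lemma eq_of_contract_mul_eq {B : Type*} [AddCommGroup B] [Module k B] {z w : M ⊗[k] (A ⊗[k] B)}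
    (h : ∀ (f : A →ₗ[k] k) (g : B →ₗ[k] k),
      contract M (LinearMap.mul' k k ∘ₗ TensorProduct.map f g) z =
        contract M (LinearMap.mul' k k ∘ₗ TensorProduct.map f g) w) : z = w := by
  refine (TensorProduct.assoc k M A B).symm.injective (eq_of_contract_eq fun g => ?_)
  refine eq_of_contract_eq fun f => ?_
  simpa [contract_contract] using h f g

/-- The coefficients of `z` in a basis of `A` are themselves contractions of `z`. This one criterion
governs both stability of subspaces and fields of definition of characters. -/
lemma mem_range_rTensor_iff (W : Submodule k M) (z : M ⊗[k] A) :
    z ∈ LinearMap.range (W.subtype.rTensor A) ↔ ∀ f : A →ₗ[k] k, contract M f z ∈ W := by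
  constructor
  · rintro ⟨y, rfl⟩ f
    simp [contract_rTensor]
  · intro h
    obtain ⟨s, hs⟩ := sum_contract_coord (Module.Free.chooseBasis k A) z
    rw [hs]
    exact Submodule.sum_mem _ fun i _ => 
      ⟨(⟨_, h ((Module.Free.chooseBasis k A).coord i)⟩ : W) ⊗ₜ Module.Free.chooseBasis k A i, by simp⟩

end Contract

/-! ### Representations as modules over the convolution algebra. -/

/-- The convolution algebra of linear forms on the coalgebra `A`. -/
abbrev ConvDual (k : Type u) (A : Type v) [Field k] [AddCommGroup A] [Module k A] :
    Type (max u v) :=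
  WithConv (A →ₗ[k] k)

namespace HModule

variable {k : Type u} {A : Type v} [Field k] [CommRing A] [HopfAlgebra k A]

/-- A representation is a module over the convolution algebra, a linear form `r` acting by
`V → V ⊗ A → V`. -/
instance convModule (V : HModule.{u, v, w} k A) : Module (ConvDual k A) V where
  smul r x := contract V r.ofConv (V.coact x)
  one_smul x := LinearMap.congr_fun V.counit x
  mul_smul r s x := by
    change contract V (r * s).ofConv (V.coact x) =
      contract V r.ofConv (V.coact (contract V s.ofConv (V.coact x)))
    -- Acting by `s` and then by `r` contracts the twice iterated coaction with `r ⊗ s`; by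
    -- coassociativity this is contraction with `(r ⊗ s) ∘ comul`, the convolution product.
    rw [← contract_rTensor, contract_contract]
    have h := LinearMap.congr_fun V.coassoc x
    simp only [LinearMap.comp_apply, LinearEquiv.coe_coe] at h
    rw [h, contract_lTensor]
    rfl
  smul_zero r := by
    change contract V r.ofConv (V.coact 0) = 0
    simp
  smul_add r x y := by
    change contract V r.ofConv (V.coact (x + y)) =
      contract V r.ofConv (V.coact x) + contract V r.ofConv (V.coact y)
    simp
  add_smul r s x := by
    change contract V (r.ofConv + s.ofConv) (V.coact x) =
      contract V r.ofConv (V.coact x) + contract V s.ofConv (V.coact x)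
    simp [contract, LinearMap.lTensor_add]
  zero_smul x := by
    change contract V 0 (V.coact x) = 0
    simp [contract]

lemma conv_smul_def (V : HModule.{u, v, w} k A) (r : ConvDual k A) (x : V) :
    r • x = contract V r.ofConv (V.coact x) := rfl

instance (V : HModule.{u, v, w} k A) : IsScalarTower k (ConvDual k A) V where
  smul_assoc c r x := by
    simp only [conv_smul_def]
    change contract V (c • r.ofConv) (V.coact x) = c • contract V r.ofConv (V.coact x)
    simp [contract, LinearMap.lTensor_smul]

/-- Linear forms on `A` separate the elements of `W ⊗ A`, so equivariance can be tested after
contraction. -/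
lemma isHom_iff (V : HModule.{u, v, w} k A) (W : HModule.{u, v, t} k A) (f : V →ₗ[k] W) :
    IsHom V W f ↔ ∀ (r : ConvDual k A) (x : V), f (r • x) = r • f x := by
  simp only [conv_smul_def]
  constructor
  · intro h r x
    have := LinearMap.congr_fun h x
    simp only [LinearMap.comp_apply] at this
    rw [this, contract_rTensor]
  · intro h
    refine LinearMap.ext fun x => eq_of_contract_eq fun g => ?_
    simpa [contract_rTensor] using (h (.toConv g) x).symm

lemma isStable_iff (V : HModule.{u, v, w} k A) (W : Submodule k V) :
    V.IsStable W ↔ ∀ (r : ConvDual k A), ∀ x ∈ W, r • x ∈ W := by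
  simp only [IsStable, mem_range_rTensor_iff, conv_smul_def]
  exact ⟨fun h r x hx => h x hx _, fun h x hx f => h (.toConv f) x hx⟩

/-- A homomorphism of `H`-modules as a map of modules over the convolution algebra. -/
def IsHom.toConvLinear {V : HModule.{u, v, w} k A} {W : HModule.{u, v, t} k A} {f : V →ₗ[k] W}
    (hf : IsHom V W f) : V →ₗ[ConvDual k A] W where
  toFun := f
  map_add' := f.map_add
  map_smul' := (isHom_iff V W f).1 hf

/-- A stable subspace as a submodule over the convolution algebra. -/
def IsStable.toConvSubmodule {V : HModule.{u, v, w} k A} {W : Submodule k V}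
    (hW : V.IsStable W) : Submodule (ConvDual k A) V where
  carrier := W
  add_mem' := W.add_mem
  zero_mem' := W.zero_mem
  smul_mem' r x hx := (isStable_iff V W).1 hW r x hx

lemma isStable_restrictScalars (V : HModule.{u, v, w} k A) (N : Submodule (ConvDual k A) V) :
    V.IsStable (N.restrictScalars k) :=
  (isStable_iff V _).2 fun r _ hx => N.smul_mem r hx

lemma isHom_subtype (V : HModule.{u, v, w} k A) (W : Submodule k V) (hW : V.IsStable W) :
    IsHom (V.sub W hW) V W.subtype :=
  (V.rTensor_comp_restrictCoact W hW).symm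

lemma coe_conv_smul (V : HModule.{u, v, w} k A) (W : Submodule k V) (hW : V.IsStable W)
    (r : ConvDual k A) (x : V.sub W hW) : W.subtype (r • x) = r • W.subtype x :=
  (isHom_iff _ _ _).1 (isHom_subtype V W hW) r x

lemma isSimple_iff (V : HModule.{u, v, w} k A) :
    V.IsSimple ↔ IsSimpleModule (ConvDual k A) V := by
  rw [isSimpleModule_iff, isSimpleOrder_iff, Submodule.nontrivial_iff]
  refine and_congr_right fun _ => ⟨fun h N => ?_, fun h W hW => ?_⟩
  · simpa using h _ (isStable_restrictScalars V N)
  · refine (h hW.toConvSubmodule).imp (fun h => ?_) fun h => ?_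
    · exact SetLike.coe_injective (congrArg (SetLike.coe (A := Submodule (ConvDual k A) V)) h)
    · exact SetLike.coe_injective (congrArg (SetLike.coe (A := Submodule (ConvDual k A) V)) h)

end HModule

/-! ### Primary decomposition over a commutative ring. -/

section PrimaryComponents

variable {R M : Type*} [CommRing R] [AddCommGroup M] [Module R M]

open Ideal Submodule

/-- In a finite sum one exponent serves all the terms, and equal powers of distinct maximal ideals
are still pairwise coprime. -/
lemma iSupIndep_primaryComponent_maximalSpectrum :
    iSupIndep fun m : MaximalSpectrum R => primaryComponent M m.asIdeal := by
  rw [iSupIndep_iff_finsetSum_eq_zero_imp_eq_zero]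
  intro s p hmem hsum
  simp only [primaryComponent_mem] at hmem
  choose! f hmem using hmem
  have hi : iSupIndep fun m : MaximalSpectrum R => torsionBySet R M ↑(m.asIdeal ^ s.sup f) := by
    rw [iSupIndep_iff_supIndep]
    exact fun _ => supIndep_torsionBySet_ideal
      fun _ _ _ _ h => (IsCoprime.pow (MaximalSpectrum.isCoprime_of_ne h)).sup_eq
  rw [iSupIndep_iff_finsetSum_eq_zero_imp_eq_zero] at hi
  refine hi _ _ (fun P hP => ?_) hsum
  exact torsionBySet_le_torsionBySet_pow _ _ (Finset.le_sup hP) _ (hmem P hP)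

/-- A module that is finite-dimensional over a field is the sum of its primary components. -/
lemma iSup_primaryComponent_maximalSpectrum (k : Type*) [Field k] [Algebra k R] [Module k M]
    [IsScalarTower k R M] [Module.Finite k M] :
    ⨆ m : MaximalSpectrum R, primaryComponent M m.asIdeal = ⊤ := by
  rw [eq_top_iff']
  intro x
  -- It suffices to treat the cyclic module generated by `x`. Although `R` need not be Artinian, `R
  -- ⧸ I` embeds into `M` and is therefore finite-dimensional.
  let I := LinearMap.ker (LinearMap.toSpanSingleton R M x)
  have : Module.Finite k (R ⧸ I) :=
    Module.Finite.of_injective (((LinearMap.range _).subtype ∘ₗ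
      (LinearMap.toSpanSingleton R M x).quotKerEquivRange.toLinearMap).restrictScalars k)
      (Subtype.val_injective.comp (LinearEquiv.injective _))
  have : IsArtinianRing (R ⧸ I) := isArtinian_of_tower k inferInstance
  have : Fintype (MaximalSpectrum (R ⧸ I)) := Fintype.ofFinite _
  obtain ⟨n, hn⟩ := IsArtinianRing.isNilpotent_nilradical (R := R ⧸ I)
  rw [IsArtinianRing.nilradical_pow_eq_iInf] at hn
  have hsurj := Ideal.Quotient.mk_surjective (I := I)
  let c : MaximalSpectrum (R ⧸ I) → MaximalSpectrum R := fun P =>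
    ⟨P.asIdeal.comap (Ideal.Quotient.mk I), have := P.isMaximal
      Ideal.comap_isMaximal_of_surjective _ hsurj⟩
  have hc : Function.Injective c := fun P Q h => MaximalSpectrum.ext
    (Ideal.comap_injective_of_surjective _ hsurj (congrArg MaximalSpectrum.asIdeal h))
  -- In `R ⧸ I` the intersection of the `n`-th powers of the maximal ideals is a power of the
  -- nilradical, hence zero; pulled back to `R`, the intersection of the powers annihilates `x`.
  have hle : ⨅ P ∈ Finset.univ, (c P).asIdeal ^ n ≤ I := by
    intro r hr
    rw [← Ideal.Quotient.eq_zero_iff_mem, ← Ideal.mem_bot, ← Ideal.zero_eq_bot, ← hn,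
      Ideal.mem_iInf]
    intro P
    simp only [Ideal.mem_iInf] at hr
    exact Ideal.le_comap_pow _ n (hr P (Finset.mem_univ _))
  have hx : x ∈ torsionBySet R M ↑(⨅ P ∈ Finset.univ, (c P).asIdeal ^ n) := by
    rw [mem_torsionBySet_iff]
    exact fun r => hle r.2
  rw [← iSup_torsionBySet_ideal_eq_torsionBySet_iInf fun P _ Q _ h =>
    (IsCoprime.pow (MaximalSpectrum.isCoprime_of_ne (hc.ne h))).sup_eq] at hx
  refine (iSup₂_le fun P _ => ?_ :
    _ ≤ ⨆ m : MaximalSpectrum R, primaryComponent M m.asIdeal) hx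
  exact le_iSup_of_le (c P) (le_iSup (fun n : ℕ => torsionBySet R M ↑((c P).asIdeal ^ n)) n)

/-- The annihilator of `x` is a prime ideal containing a power of `m`, hence containing `m`. Since
`x` generates `M` and `R` is commutative, `m` kills all of `M`, and maximality gives equality. -/
lemma IsSimpleModule.annihilator_eq_of_mem_primaryComponent [IsSimpleModule R M] {m : Ideal R}
    (hm : m.IsMaximal) {x : M} (hx : x ∈ primaryComponent M m) (h0 : x ≠ 0) :
    Module.annihilator R M = m := by
  obtain ⟨n, hn⟩ := (primaryComponent_mem _ _ _).1 hx
  rw [mem_torsionBySet_iff] at hn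
  have hK := IsSimpleModule.ker_toSpanSingleton_isMaximal R h0
  have hmK : m ≤ LinearMap.ker (LinearMap.toSpanSingleton R M x) := by
    have := hK.isPrime
    exact Ideal.IsPrime.le_of_pow_le (n := n) fun r hr => hn ⟨r, hr⟩
  refine (hm.eq_of_le IsSimpleModule.annihilator_isMaximal.ne_top fun r hr => ?_).symm
  rw [Module.mem_annihilator]
  intro y
  obtain ⟨s, rfl⟩ := IsSimpleModule.toSpanSingleton_surjective R h0 y
  have : r • x = 0 := hmK hr
  simp only [LinearMap.toSpanSingleton_apply]
  rw [smul_comm, this, smul_zero]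

lemma exists_simple_of_primaryComponent_ne_bot [IsArtinian R M] {m : Ideal R}
    (hm : m.IsMaximal) (h : primaryComponent M m ≠ ⊥) :
    ∃ S : Submodule R M, IsSimpleModule R S ∧ Module.annihilator R S = m := by
  obtain ⟨S, hS, hle⟩ := (eq_bot_or_exists_atom_le (primaryComponent M m)).resolve_left h
  have hS' : IsSimpleModule R S := isSimpleModule_iff_isAtom.2 hS
  have := IsSimpleModule.nontrivial R S
  obtain ⟨x, hx⟩ := exists_ne (0 : S)
  refine ⟨S, hS', IsSimpleModule.annihilator_eq_of_mem_primaryComponent hm (x := x) ?_ hx⟩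
  obtain ⟨n, hn⟩ := (primaryComponent_mem _ _ _).1 (hle x.2)
  rw [primaryComponent_mem]
  refine ⟨n, ?_⟩
  rw [mem_torsionBySet_iff] at hn ⊢
  exact fun a => Subtype.ext (hn a)

end PrimaryComponents

/-! ### Characters as algebra homomorphisms on the convolution algebra. -/

namespace HCharacter

variable {k : Type u} {A : Type v} {kbar : Type w} [Field k] [CommRing A] [HopfAlgebra k A]
  [Field kbar] [Algebra k kbar]

section

variable {R : Type*} [CommRing R] [Algebra k R]

lemma lTensor_comul_eq_d0 (z : R ⊗[k] A) :
    (Coalgebra.comul (R := k) (A := A)).lTensor R z = d0 k A R z := by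
  induction z with
  | zero => simp
  | tmul x a => simp [d0]
  | add x y hx hy => simp only [map_add, hx, hy]

lemma contract_counit (z : R ⊗[k] A) :
    contract R (Coalgebra.counit (R := k) (A := A)) z = ev k A R z := by
  induction z with
  | zero => simp
  | tmul x a => simp [ev]
  | add x y hx hy => simp only [map_add, hx, hy]

/-- The product `d1 z * d2 w` is `z ⊗ w` over `R`, so the group-like equation `d0 z = d1 z * d2 z`
turns into multiplicativity of contraction. -/
lemma contract_d1_mul_d2 (f g : A →ₗ[k] k) (z w : R ⊗[k] A) :
    contract R (LinearMap.mul' k k ∘ₗ TensorProduct.map f g) (d1 k A R z * d2 k A R w) =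
      contract R f z * contract R g w := by
  induction z with
  | zero => simp
  | tmul x a =>
    induction w with
    | zero => simp
    | tmul y b => simp [d1, d2, smul_smul, mul_comm]
    | add x y hx hy => simp only [map_add, mul_add, hx, hy]
  | add x y hx hy => simp only [map_add, add_mul, hx, hy]

lemma contract_convMul (r s : ConvDual k A) (z : R ⊗[k] A) :
    contract R (r * s).ofConv z =
      contract R (LinearMap.mul' k k ∘ₗ TensorProduct.map r.ofConv s.ofConv) (d0 k A R z) := by
  rw [← lTensor_comul_eq_d0, contract_lTensor]
  rfl

/-- An element of `R ⊗ A` is group-like if and only if contraction with it is multiplicative on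
the convolution algebra. -/
lemma isGroupLikeElem_iff_contract (z : R ⊗[k] A) :
    IsGroupLikeElem R z ↔ contract R (1 : ConvDual k A).ofConv z = 1 ∧
      ∀ r s : ConvDual k A,
        contract R (r * s).ofConv z = contract R r.ofConv z * contract R s.ofConv z := by
  rw [isGroupLikeElem_iff_coface, ← contract_counit]
  refine and_congr Iff.rfl ⟨fun h r s => ?_, fun h => eq_of_contract_mul_eq fun f g => ?_⟩
  · rw [contract_convMul, h, contract_d1_mul_d2]
  · rw [contract_d1_mul_d2]
    exact (contract_convMul (.toConv f) (.toConv g) z).symm.trans (h _ _)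

lemma contract_add_left (r s : ConvDual k A) (z : R ⊗[k] A) :
    contract R (r + s).ofConv z = contract R r.ofConv z + contract R s.ofConv z := by
  change contract R (r.ofConv + s.ofConv) z = _
  simp [contract, LinearMap.lTensor_add]

lemma contract_smul_left (c : k) (r : ConvDual k A) (z : R ⊗[k] A) :
    contract R (c • r).ofConv z = c • contract R r.ofConv z := by
  change contract R (c • r.ofConv) z = _
  simp [contract, LinearMap.lTensor_smul]

lemma contract_includeLeft_mul (f : A →ₗ[k] k) (x : R) (z : R ⊗[k] A) :
    contract R f (x ⊗ₜ 1 * z) = x * contract R f z := by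
  induction z with
  | zero => simp
  | tmul y a => simp
  | add y z hy hz => simp only [map_add, mul_add, hy, hz]

end

/-- The algebra homomorphism from the convolution algebra to `kbar` given by a character. -/
def evalHom (χ : HCharacter k A kbar) : ConvDual k A →ₐ[k] kbar :=
  AlgHom.ofLinearMap
    { toFun := fun r => contract kbar r.ofConv χ.val
      map_add' := fun r s => contract_add_left r s _
      map_smul' := fun c r => contract_smul_left c r _ }
    ((isGroupLikeElem_iff_contract _).1 χ.2).1 ((isGroupLikeElem_iff_contract _).1 χ.2).2

lemma evalHom_apply (χ : HCharacter k A kbar) (r : ConvDual k A) :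
    χ.evalHom r = contract kbar r.ofConv χ.val := rfl

/-- An algebra homomorphism given by contraction with an element of `kbar ⊗ A` comes from a
character. -/
lemma exists_evalHom_eq (φ : ConvDual k A →ₐ[k] kbar) (z : kbar ⊗[k] A)
    (h : ∀ r : ConvDual k A, contract kbar r.ofConv z = φ r) :
    ∃ χ : HCharacter k A kbar, χ.evalHom = φ := by
  have hz : IsGroupLikeElem kbar z := (isGroupLikeElem_iff_contract z).2
    ⟨by rw [h, map_one], fun r s => by rw [h, h, h, map_mul]⟩
  exact ⟨⟨z, hz⟩, AlgHom.ext fun r => h r⟩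

lemma evalHom_injective {χ χ' : HCharacter k A kbar} (h : χ.evalHom = χ'.evalHom) : χ = χ' := by
  refine GroupLike.ext (eq_of_contract_eq fun f => ?_)
  have := DFunLike.congr_fun h (.toConv f)
  rwa [evalHom_apply, evalHom_apply] at this

lemma bc_eq_rTensor {R R' : Type*} [CommRing R] [Algebra k R] [CommRing R'] [Algebra k R']
    (f : R →ₐ[k] R') (z : R ⊗[k] A) : bc f A z = f.toLinearMap.rTensor A z := rfl

lemma evalHom_smul (γ : Gal(kbar/k)) (χ : HCharacter k A kbar) (r : ConvDual k A) :
    (γ • χ).evalHom r = γ (χ.evalHom r) := by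
  rw [evalHom_apply, smul_val, bc_eq_rTensor, contract_rTensor]
  rfl

/-- This identifies `k(χ)` as the smallest subextension containing all values of `χ.evalHom`. -/
lemma isDefinedOver_iff (χ : HCharacter k A kbar) (K : IntermediateField k kbar) :
    χ.IsDefinedOver K ↔ ∀ r, χ.evalHom r ∈ K :=
  (mem_range_rTensor_iff K.toSubmodule χ.val).trans
    ⟨fun h r => h r.ofConv, fun h f => h (.toConv f)⟩

lemma evalHom_mem_fieldOfDef (χ : HCharacter k A kbar) (r : ConvDual k A) :
    χ.evalHom r ∈ χ.fieldOfDef :=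
  (isDefinedOver_iff _ _).1 χ.isDefinedOver_fieldOfDef r

/-- A tensor involves only finitely many coefficients in `kbar`, and these span all the values. -/
lemma finite_range_evalHom (χ : HCharacter k A kbar) : Module.Finite k χ.evalHom.range := by
  obtain ⟨s, hs⟩ := sum_contract_coord (Module.Free.chooseBasis k A) χ.val
  let c := fun i => contract kbar ((Module.Free.chooseBasis k A).coord i) χ.val
  have hle : Subalgebra.toSubmodule χ.evalHom.range ≤ Submodule.span k (c '' s) := by
    rintro _ ⟨r, rfl⟩
    change contract kbar r.ofConv χ.val ∈ _
    rw [hs, map_sum]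
    refine Submodule.sum_mem _ fun i hi => ?_
    rw [contract_tmul]
    exact Submodule.smul_mem _ _ (Submodule.subset_span ⟨i, hi, rfl⟩)
  have : Module.Finite k (Submodule.span k (c '' s)) :=
    Module.Finite.span_of_finite k (s.finite_toSet.image c)
  exact Module.Finite.of_injective (Submodule.inclusion hle) (Submodule.inclusion_injective hle)

/-- The field of definition of a character consists of its values on the convolution algebra. -/
lemma exists_evalHom_eq_of_mem_fieldOfDef (χ : HCharacter k A kbar) {x : kbar}
    (hx : x ∈ χ.fieldOfDef) : ∃ r, χ.evalHom r = x := by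
  have := χ.finite_range_evalHom
  -- The ring of values is finite-dimensional over `k`, so it is algebraic and thus already a field;
  -- as `χ` is defined over it, it contains `k(χ)`.
  have h : χ.fieldOfDef ≤ Algebra.IsAlgebraic.toIntermediateField χ.evalHom.range :=
    sInf_le ((isDefinedOver_iff _ _).2 fun r => ⟨r, rfl⟩)
  exact h hx

lemma finite_fieldOfDef (χ : HCharacter k A kbar) : Module.Finite k χ.fieldOfDef := by
  have := χ.finite_range_evalHom
  have hle : χ.fieldOfDef.toSubmodule ≤ Subalgebra.toSubmodule χ.evalHom.range :=
    fun _ hx => χ.exists_evalHom_eq_of_mem_fieldOfDef hx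
  exact Module.Finite.of_injective (Submodule.inclusion hle) (Submodule.inclusion_injective hle)

/-- `evalHom` with values in the field of definition. -/
def evalHomFieldOfDef (χ : HCharacter k A kbar) : ConvDual k A →ₐ[k] χ.fieldOfDef :=
  χ.evalHom.codRestrict χ.fieldOfDef.toSubalgebra χ.evalHom_mem_fieldOfDef

lemma evalHomFieldOfDef_surjective (χ : HCharacter k A kbar) :
    Function.Surjective χ.evalHomFieldOfDef := fun x =>
  (χ.exists_evalHom_eq_of_mem_fieldOfDef x.2).imp fun _ h => Subtype.ext h

lemma ker_evalHomFieldOfDef (χ : HCharacter k A kbar) :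
    RingHom.ker χ.evalHomFieldOfDef = RingHom.ker χ.evalHom := by
  ext r
  exact Subtype.ext_iff

/-- Makes `k(χ)` a quotient of the convolution algebra through `evalHomFieldOfDef`. The ascriptions
let `r` act through the coaction of `χ.toHModule`, while the product on the right is taken in the
field `k(χ)`. -/
lemma toHModule_smul (χ : HCharacter k A kbar) (r : ConvDual k A) (x : χ.fieldOfDef) :
    (HSMul.hSMul (α := ConvDual k A) (β := χ.toHModule) (γ := χ.toHModule) r x : χ.fieldOfDef) =
      χ.evalHomFieldOfDef r * x := by
  have h : (HSMul.hSMul (α := ConvDual k A) (β := χ.toHModule) (γ := χ.toHModule) r x :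
      χ.fieldOfDef) = x * contract χ.fieldOfDef r.ofConv χ.descent :=
    contract_includeLeft_mul r.ofConv (R := χ.fieldOfDef) x χ.descent
  have h' : contract χ.fieldOfDef r.ofConv χ.descent = χ.evalHomFieldOfDef r := by
    refine Subtype.ext ?_
    change χ.fieldOfDef.val.toLinearMap _ = contract kbar r.ofConv χ.val
    rw [← contract_rTensor, ← bc_descent]
    rfl
  rw [h, h', mul_comm]

end HCharacter

lemma mem_primaryComponent_iff_of_injective {R M N : Type*} [CommRing R] [AddCommGroup M]
    [Module R M] [AddCommGroup N] [Module R N] (I : Ideal R) (f : M →ₗ[R] N)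
    (hf : Function.Injective f) (x : M) :
    f x ∈ I.primaryComponent N ↔ x ∈ I.primaryComponent M := by
  simp only [Ideal.primaryComponent_mem, Submodule.mem_torsionBySet_iff, ← map_smul,
    map_eq_zero_iff f hf]

lemma IsField.exists_algHom_injective {F L : Type*} (E : Type*) [Field F] [CommRing L]
    [Algebra F L] [Module.Finite F L] [Field E] [Algebra F E] [IsAlgClosed E]
    (hL : IsField L) : ∃ σ : L →ₐ[F] E, Function.Injective σ := by
  let := hL.toField
  exact ⟨IsAlgClosed.lift, RingHom.injective _⟩

/-! ### Simple modules, extensions and maximal ideals. -/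

section

variable {k : Type u} {A : Type v} {kbar : Type w} [Field k] [CommRing A] [HopfAlgebra k A]
  [Field kbar] [Algebra k kbar]

namespace HModule

lemma IsIso.annihilator_eq {V : HModule.{u, v, w} k A} {W : HModule.{u, v, t} k A}
    (h : V.IsIso W) : Module.annihilator (ConvDual k A) V = Module.annihilator (ConvDual k A) W := by
  obtain ⟨e, he⟩ := h
  exact LinearEquiv.annihilator_eq (LinearEquiv.ofBijective he.toConvLinear e.bijective)

lemma IsHom.comp {U V W : HModule.{u, v, w} k A} {g : V →ₗ[k] W} {f : U →ₗ[k] V}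
    (hg : IsHom V W g) (hf : IsHom U V f) : IsHom U W (g ∘ₗ f) := by
  rw [isHom_iff] at *
  simp [hf, hg]

lemma IsHom.add {V W : HModule.{u, v, w} k A} {f g : V →ₗ[k] W}
    (hf : IsHom V W f) (hg : IsHom V W g) : IsHom V W (f + g) := by
  rw [isHom_iff] at *
  simp [hf, hg]

variable [Coalgebra.IsCocomm k A]

/-- Over a commutative ring a simple module is the quotient of the ring by its annihilator. -/
lemma isIso_of_annihilator_eq {V : HModule.{u, v, w} k A} {W : HModule.{u, v, t} k A}
    (hV : V.IsSimple) (hW : W.IsSimple)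
    (h : Module.annihilator (ConvDual k A) V = Module.annihilator (ConvDual k A) W) :
    V.IsIso W := by
  obtain ⟨I, -, ⟨e⟩⟩ := isSimpleModule_iff_quot_maximal.1 ((isSimple_iff V).1 hV)
  obtain ⟨J, -, ⟨e'⟩⟩ := isSimpleModule_iff_quot_maximal.1 ((isSimple_iff W).1 hW)
  rw [e.annihilator_eq, e'.annihilator_eq, Ideal.annihilator_quotient,
    Ideal.annihilator_quotient] at h
  subst h
  exact ⟨(e.trans e'.symm).restrictScalars k,
    (isHom_iff _ _ _).2 fun r x => (e.trans e'.symm).map_smul r x⟩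

/-- Extensions of modules with coprime annihilators split. -/
theorem Extension.rel_split_of_isCoprime {M N : HModule.{u, v, w} k A}
    (h : IsCoprime (Module.annihilator (ConvDual k A) M) (Module.annihilator (ConvDual k A) N))
    (X : Extension M N) : X.Rel (Extension.split M N) := by
  -- With `a + b = 1`, the element `a` acts as zero on `M` and as the identity on `N`.
  -- Multiplication by `a` therefore maps the extension into the image of `N` and yields an
  -- equivariant retraction `ρ`; the equivalence with the split extension is `x ↦ (p x, ρ x)`.
  obtain ⟨a, ha, b, hb, hab⟩ := Ideal.isCoprime_iff_exists.1 h
  rw [Module.mem_annihilator] at ha hb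
  have haN : ∀ y : N, a • y = y := fun y => by
    rw [eq_sub_of_add_eq hab, sub_smul, hb, one_smul, sub_zero]
  have hmem : ∀ x, LinearMap.lsmul (ConvDual k A) X.E a x ∈
      LinearMap.range X.isHom_i.toConvLinear := fun x => by
    refine (X.exact _).1 ?_
    exact ((isHom_iff _ _ _).1 X.isHom_p a x).trans (ha _)
  let ρ : X.E →ₗ[ConvDual k A] N :=
    (LinearEquiv.ofInjective X.isHom_i.toConvLinear X.injective_i).symm.toLinearMap ∘ₗ
      (LinearMap.lsmul (ConvDual k A) X.E a).codRestrict _ hmem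
  have hρ : ∀ x, X.i (ρ x) = a • x := fun x => congrArg Subtype.val
    ((LinearEquiv.ofInjective X.isHom_i.toConvLinear X.injective_i).apply_symm_apply
      ⟨_, hmem x⟩)
  have hρN : ∀ y, ρ (X.i y) = y := fun y => X.injective_i <| by
    rw [hρ, ← (isHom_iff _ _ _).1 X.isHom_i, haN]
  have hρ' : IsHom X.E N (ρ.restrictScalars k) := (isHom_iff _ _ _).2 ρ.map_smul
  have hl : IsHom M (M.prod N) (LinearMap.inl k M N) := LinearMap.coprod_inl _ _
  have hr : IsHom N (M.prod N) (LinearMap.inr k M N) := LinearMap.coprod_inr _ _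
  refine ⟨LinearMap.inl k M N ∘ₗ X.p + LinearMap.inr k M N ∘ₗ ρ.restrictScalars k,
    (hl.comp X.isHom_p).add (hr.comp hρ'), ?_, ?_⟩
  · refine LinearMap.ext fun y => Prod.ext ?_ ?_
    · change X.p (X.i y) + 0 = 0
      rw [X.exact.apply_apply_eq_zero, add_zero]
    · change 0 + ρ (X.i y) = y
      rw [hρN, zero_add]
  · refine LinearMap.ext fun x => ?_
    change X.p x + 0 = X.p x
    rw [add_zero]

end HModule

namespace HCharacter

open HModule

lemma isSimple_toHModule (χ : HCharacter k A kbar) : χ.toHModule.IsSimple := by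
  rw [isSimple_iff, isSimpleModule_iff_toSpanSingleton_surjective]
  refine ⟨inferInstanceAs (Nontrivial χ.fieldOfDef), fun x hx y => ?_⟩
  -- Any nonzero `x` generates: choose `r` on which `χ` takes the value `y / x`.
  obtain ⟨r, hr⟩ := χ.evalHomFieldOfDef_surjective
    ((show χ.fieldOfDef from y) / (show χ.fieldOfDef from x))
  refine ⟨r, (χ.toHModule_smul r x).trans ?_⟩
  rw [hr]
  exact div_mul_cancel₀ (G₀ := χ.fieldOfDef) y hx

lemma annihilator_toHModule (χ : HCharacter k A kbar) :
    Module.annihilator (ConvDual k A) χ.toHModule = RingHom.ker χ.evalHom := by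
  rw [← ker_evalHomFieldOfDef]
  ext r
  rw [Module.mem_annihilator, RingHom.mem_ker]
  constructor
  · intro h
    have := (χ.toHModule_smul r 1).symm.trans (h _)
    rwa [mul_one] at this
  · intro h x
    refine (χ.toHModule_smul r x).trans ?_
    rw [h]
    exact zero_mul (M₀ := χ.fieldOfDef) x

variable [Coalgebra.IsCocomm k A]

/-- The maximal ideal of the convolution algebra attached to a character. -/
def maximal (χ : HCharacter k A kbar) : MaximalSpectrum (ConvDual k A) where
  asIdeal := RingHom.ker χ.evalHom
  isMaximal := by
    have := (isSimple_iff _).1 χ.isSimple_toHModule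
    rw [← annihilator_toHModule]
    exact IsSimpleModule.annihilator_isMaximal

lemma annihilator_toHModule_eq_maximal (χ : HCharacter k A kbar) :
    Module.annihilator (ConvDual k A) χ.toHModule = χ.maximal.asIdeal :=
  χ.annihilator_toHModule

variable [IsAlgClosure k kbar]

/-- Equal kernels give a `k`-embedding of `k(χ)` into `kbar` carrying the values of `χ` to those of
`χ'`. It extends to an endomorphism of `kbar`, which is bijective because `kbar` is algebraic over
`k`; separability plays no role. -/
lemma maximal_eq_iff (χ χ' : HCharacter k A kbar) :
    χ'.maximal = χ.maximal ↔ χ' ∈ MulAction.orbit Gal(kbar/k) χ := by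
  have : Algebra.IsAlgebraic k kbar := IsAlgClosure.isAlgebraic
  have : IsAlgClosed kbar := IsAlgClosure.isAlgClosed k
  constructor
  · intro h
    have hker : RingHom.ker χ'.evalHom = RingHom.ker χ.evalHom :=
      congrArg MaximalSpectrum.asIdeal h
    let φ : χ.fieldOfDef →ₐ[k] kbar := AlgHom.liftOfSurjective χ.evalHomFieldOfDef
      χ.evalHomFieldOfDef_surjective χ'.evalHom (χ.ker_evalHomFieldOfDef.trans hker.symm).le
    have hφ : ∀ r, φ (χ.evalHomFieldOfDef r) = χ'.evalHom r :=
      AlgHom.liftOfSurjective_apply _ _ _ _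
    obtain ⟨ψ, hψ⟩ := IsAlgClosed.surjective_domRestrict_of_isAlgebraic (E := kbar) φ
    refine ⟨AlgEquiv.ofBijective ψ (Algebra.IsAlgebraic.algHom_bijective ψ), ?_⟩
    refine evalHom_injective (AlgHom.ext fun r => ?_)
    rw [← hφ, ← hψ]
    exact evalHom_smul _ χ r
  · rintro ⟨γ, rfl⟩
    refine MaximalSpectrum.ext (Ideal.ext fun r => ?_)
    change (γ • χ).evalHom r = 0 ↔ χ.evalHom r = 0
    rw [evalHom_smul]
    exact map_eq_zero_iff γ γ.injective

/-- The annihilator of a finite-dimensional simple `H`-module is the maximal ideal of a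
character. -/
theorem exists_annihilator_eq_maximal (S : HModule.{u, v, t} k A) [Module.Finite k S]
    (hS : S.IsSimple) :
    ∃ χ : HCharacter k A kbar, Module.annihilator (ConvDual k A) S = χ.maximal.asIdeal := by
  have : IsAlgClosed kbar := IsAlgClosure.isAlgClosed k
  obtain ⟨I, hI, ⟨e⟩⟩ := isSimpleModule_iff_quot_maximal.1 ((isSimple_iff S).1 hS)
  have : Module.Finite k (ConvDual k A ⧸ I) := Module.Finite.equiv (e.restrictScalars k)
  obtain ⟨σ, hσ⟩ := IsField.exists_algHom_injective (F := k) (L := ConvDual k A ⧸ I) kbar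
    ((Ideal.Quotient.maximal_ideal_iff_isField_quotient I).1 hI)
  -- An arbitrary homomorphism from the dual to `kbar` need not be contraction with an element of
  -- `kbar ⊗ A`. Here it is, since `S` carries a coaction: apply `σ ∘ e` to the first factor of the
  -- coaction on the generator `e.symm 1`.
  obtain ⟨χ, hχ⟩ := exists_evalHom_eq (σ.comp (Ideal.Quotient.mkₐ k I))
    ((σ.toLinearMap ∘ₗ (e.restrictScalars k).toLinearMap).rTensor A (S.coact (e.symm 1)))
    fun r => by
      rw [contract_rTensor, ← conv_smul_def]
      change σ (e (r • e.symm 1)) = σ (Ideal.Quotient.mk I r)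
      rw [map_smul, e.apply_symm_apply]
      exact congrArg (fun y => σ (Ideal.Quotient.mk I y)) (mul_one r)
  refine ⟨χ, ?_⟩
  rw [e.annihilator_eq, Ideal.annihilator_quotient]
  ext r
  change r ∈ I ↔ χ.evalHom r = 0
  rw [hχ]
  change _ ↔ σ (Ideal.Quotient.mk I r) = 0
  rw [map_eq_zero_iff σ hσ, Ideal.Quotient.eq_zero_iff_mem]

end HCharacter

end

/-! ### Blocks as primary components. -/

namespace HModule

variable {k : Type u} {A : Type v} {kbar : Type w} [Field k] [CommRing A] [HopfAlgebra k A]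
  [Field kbar] [Algebra k kbar]

open HCharacter

lemma isCompositionFactor_of_isSimple (V : HModule.{u, v, t} k A) (W : Submodule k V) (hW : V.IsStable W)
    (h : (V.sub W hW).IsSimple) : (V.sub W hW).IsCompositionFactor V :=
  ⟨h, V.sub W hW, W.subtype, LinearMap.id, isHom_subtype V W hW, W.injective_subtype,
    (isHom_iff _ _ _).2 fun _ _ => rfl, Function.surjective_id⟩

variable [Coalgebra.IsCocomm k A]

/-- A stable subspace, as a submodule over the convolution algebra, is isomorphic to the
corresponding `H`-module. -/
def subEquiv (V : HModule.{u, v, w} k A) (N : Submodule (ConvDual k A) V) :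
    V.sub (N.restrictScalars k) (isStable_restrictScalars V N) ≃ₗ[ConvDual k A] N where
  toFun x := x
  invFun x := x
  map_add' _ _ := rfl
  map_smul' r x := Subtype.ext (coe_conv_smul V _ (isStable_restrictScalars V N) r x)
  left_inv _ := rfl
  right_inv _ := rfl

variable (V : HModule.{u, v, t} k A)

/-- A nonzero primary component of `V` gives rise to a simple stable subspace of `V`. -/
lemma exists_isSimple_sub [Module.Finite k V] (m : MaximalSpectrum (ConvDual k A))
    (h : m.asIdeal.primaryComponent V ≠ ⊥) :
    ∃ (W : Submodule k V) (hW : V.IsStable W), (V.sub W hW).IsSimple ∧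
      Module.annihilator (ConvDual k A) (V.sub W hW) = m.asIdeal := by
  have : IsArtinian (ConvDual k A) V := isArtinian_of_tower k inferInstance
  obtain ⟨S, hS, hm⟩ := exists_simple_of_primaryComponent_ne_bot m.isMaximal h
  refine ⟨S.restrictScalars k, isStable_restrictScalars V S, ?_, ?_⟩
  · rw [isSimple_iff]
    exact (subEquiv V S).isSimpleModule_iff.2 hS
  · rw [(subEquiv V S).annihilator_eq, hm]

lemma isIso_toHModule (χ : HCharacter k A kbar) {S : HModule.{u, v, t} k A} (hS : S.IsSimple)
    (h : Module.annihilator (ConvDual k A) S = χ.maximal.asIdeal) : S.IsIso χ.toHModule :=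
  isIso_of_annihilator_eq hS χ.isSimple_toHModule (h.trans χ.annihilator_toHModule_eq_maximal.symm)

/-- `V` belongs to the block of `χ` if and only if it is primary for the maximal ideal of `χ`. -/
theorem inBlock_iff (χ : HCharacter k A kbar) :
    V.InBlock χ ↔ Module.Finite k V ∧ χ.maximal.asIdeal.primaryComponent V = ⊤ := by
  refine and_congr_right fun _ => ⟨fun h => ?_, fun h S hS => ?_⟩
  · rw [← top_le_iff, ← iSup_primaryComponent_maximalSpectrum (R := ConvDual k A) (M := V) k]
    refine iSup_le fun m => ?_
    by_cases hm : m.asIdeal.primaryComponent V = ⊥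
    · rw [hm]
      exact bot_le
    -- A nonzero component contains a simple submodule with annihilator `m`; being a composition
    -- factor it is isomorphic to `k(χ)`, so `m` is the ideal of `χ`.
    · obtain ⟨W, hW, hs, ha⟩ := V.exists_isSimple_sub m hm
      have := (h _ (V.isCompositionFactor_of_isSimple W hW hs)).annihilator_eq
      rw [ha, annihilator_toHModule_eq_maximal] at this
      rw [this]
  · obtain ⟨hs, U, i, q, hi, hi', hq, hq'⟩ := hS
    refine isIso_toHModule χ hs ?_
    have hs' := (isSimple_iff S).1 hs
    have := hs.1
    -- A nonzero element of `S` lifts to `U ⊆ V`, so a power of the ideal of `χ` kills it, which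
    -- determines the annihilator of `S`.
    obtain ⟨x, hx⟩ := exists_ne (0 : S)
    refine IsSimpleModule.annihilator_eq_of_mem_primaryComponent χ.maximal.isMaximal ?_ hx
    obtain ⟨y, rfl⟩ := hq' x
    refine Ideal.primaryComponent_map_mem _ hq.toConvLinear ⟨y, ?_⟩
    rw [← mem_primaryComponent_iff_of_injective _ hi.toConvLinear hi', h]
    trivial

lemma inBlock_sub_iff [Module.Finite k V] (χ : HCharacter k A kbar) (W : Submodule k V)
    (hW : V.IsStable W) :
    (V.sub W hW).InBlock χ ↔ hW.toConvSubmodule ≤ χ.maximal.asIdeal.primaryComponent V := by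
  have : Module.Finite k (V.sub W hW) := inferInstanceAs (Module.Finite k W)
  rw [inBlock_iff, and_iff_right this, Submodule.eq_top_iff']
  simp only [← mem_primaryComponent_iff_of_injective _ (isHom_subtype V W hW).toConvLinear
    W.injective_subtype]
  exact ⟨fun h x hx => h ⟨x, hx⟩, fun h x => h x.2⟩

lemma inBlock_toHModule [IsAlgClosure k kbar] (χ : HCharacter k A kbar) :
    χ.toHModule.InBlock χ := by
  refine (inBlock_iff _ χ).2 ⟨χ.finite_fieldOfDef, Submodule.eq_top_iff'.2 fun x => ?_⟩
  rw [Ideal.primaryComponent_mem]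
  refine ⟨1, ?_⟩
  rw [Submodule.mem_torsionBySet_iff, pow_one]
  intro r
  exact Module.mem_annihilator.1 (χ.annihilator_toHModule_eq_maximal.ge r.2) x

-- The image of `f` lies in the primary components of `V'` for two distinct maximal ideals, and
-- these are disjoint.
variable {V} in
lemma eq_zero_of_inBlock {V' : HModule.{u, v, t} k A} {χ χ' : HCharacter k A kbar}
    (hne : χ'.maximal ≠ χ.maximal) (hV : V.InBlock χ) (hV' : V'.InBlock χ') {f : V →ₗ[k] V'}
    (hf : IsHom V V' f) : f = 0 := by
  refine LinearMap.ext fun x => ?_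
  have h := iSupIndep_primaryComponent_maximalSpectrum (R := ConvDual k A) (M := V')
    |>.pairwiseDisjoint hne
  simp only [Function.onFun] at h
  refine Submodule.disjoint_def.1 h (f x) ?_ ?_
  · rw [((inBlock_iff _ _).1 hV').2]
    trivial
  · refine Ideal.primaryComponent_map_mem _ hf.toConvLinear ⟨x, ?_⟩
    rw [((inBlock_iff _ _).1 hV).2]
    trivial

variable [IsAlgClosure k kbar]

variable (k A kbar) in
/-- The maximal ideal of the convolution algebra attached to a Galois orbit of characters. -/
def orbitMaximal (o : MulAction.orbitRel.Quotient Gal(kbar/k) (HCharacter k A kbar)) :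
    MaximalSpectrum (ConvDual k A) :=
  Quotient.lift maximal (fun _ _ h => (maximal_eq_iff _ _).2 h) o

lemma orbitMaximal_injective : Function.Injective (orbitMaximal k A kbar) := by
  rintro ⟨χ⟩ ⟨χ'⟩ h
  exact Quotient.sound ((maximal_eq_iff χ' χ).1 h)

-- The components at all maximal ideals already decompose `V`. Those at ideals not coming from
-- characters vanish: a nonzero component contains a finite-dimensional simple module, whose
-- annihilator is the ideal of a character.
open Classical in
lemma isInternal_primaryComponent [Module.Finite k V] :
    DirectSum.IsInternal fun o =>
      (orbitMaximal k A kbar o).asIdeal.primaryComponent (V : Type t) := by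
  rw [DirectSum.isInternal_submodule_iff_iSupIndep_and_iSup_eq_top]
  refine ⟨iSupIndep_primaryComponent_maximalSpectrum.comp orbitMaximal_injective, ?_⟩
  rw [← top_le_iff, ← iSup_primaryComponent_maximalSpectrum (R := ConvDual k A) (M := V) k]
  refine iSup_le fun m => ?_
  by_cases hm : m.asIdeal.primaryComponent V = ⊥
  · rw [hm]
    exact bot_le
  · obtain ⟨W, hW, hs, ha⟩ := V.exists_isSimple_sub m hm
    have : Module.Finite k (V.sub W hW) := inferInstanceAs (Module.Finite k W)
    obtain ⟨χ, hχ⟩ := exists_annihilator_eq_maximal (kbar := kbar) _ hs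
    rw [ha] at hχ
    rw [hχ]
    exact le_iSup (fun o => (orbitMaximal k A kbar o).asIdeal.primaryComponent V)
      (Quotient.mk _ χ)

theorem existsUnique_isBlockDecomposition [Module.Finite k V] :
    ∃! W : MulAction.orbitRel.Quotient Gal(kbar/k) (HCharacter k A kbar) →
      {W : Submodule k V // V.IsStable W}, V.IsBlockDecomposition W := by
  classical
  refine ⟨fun o => ⟨((orbitMaximal k A kbar o).asIdeal.primaryComponent V).restrictScalars k,
    isStable_restrictScalars V _⟩, ⟨?_, fun χ => ?_⟩, fun W hW => ?_⟩
  -- Internality concerns only the underlying additive groups, so it is the same over `k` as over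
  -- the convolution algebra.
  · convert! V.isInternal_primaryComponent (kbar := kbar)
  · rw [inBlock_sub_iff]
    exact fun x hx => hx
  · obtain ⟨hint, hblock⟩ := hW
    have hle : ∀ o, (W o).2.toConvSubmodule ≤
        (orbitMaximal k A kbar o).asIdeal.primaryComponent V := by
      rintro ⟨χ⟩
      exact (inBlock_sub_iff V χ _ _).1 (hblock χ)
    have hint' : DirectSum.IsInternal fun o => (W o).2.toConvSubmodule := by
      convert! hint
    have htop := hint'.submodule_iSup_eq_top
    have hind := (V.isInternal_primaryComponent (kbar := kbar)).submodule_iSupIndep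
    -- Each summand `W o` lies in the corresponding primary component; the components are
    -- independent and the `W o` already span `V`, which forces equality.
    have heq := (hind.le_iff_eq_of_iSup_eq_top htop).1 hle
    exact funext fun o => Subtype.ext (SetLike.coe_injective
      (congrArg (SetLike.coe (A := Submodule (ConvDual k A) V)) (congrFun heq o)))

end HModule

end

theorem mainTheorem10 (k : Type u) (A : Type v) (kbar : Type w) [Field k] [CommRing A]
    [HopfAlgebra k A] [Coalgebra.IsCocomm k A] [Field kbar] [Algebra k kbar]
    [IsAlgClosure k kbar] :
    (∀ χ χ' : HCharacter k A kbar, χ' ∉ MulAction.orbit Gal(kbar/k) χ →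
      ∀ e : HModule.Ext1 χ.toHModule χ'.toHModule, e = 0) ∧
    (∀ χ : HCharacter k A kbar, χ.toHModule.IsSimple ∧ χ.toHModule.InBlock χ) ∧
    (∀ χ χ' : HCharacter k A kbar, χ' ∈ MulAction.orbit Gal(kbar/k) χ →
      ∀ V : HModule.{u, v, t} k A, V.InBlock χ' ↔ V.InBlock χ) ∧
    (∀ χ χ' : HCharacter k A kbar, χ' ∉ MulAction.orbit Gal(kbar/k) χ →
      ∀ V V' : HModule.{u, v, t} k A, V.InBlock χ → V'.InBlock χ' →
        ∀ f : V →ₗ[k] V', HModule.IsHom V V' f → f = 0) ∧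
    (∀ V : HModule.{u, v, t} k A, Module.Finite k V →
      ∃! W : MulAction.orbitRel.Quotient Gal(kbar/k) (HCharacter k A kbar) →
          {W : Submodule k V // V.IsStable W},
        V.IsBlockDecomposition W) := by
  refine ⟨fun χ χ' h e => ?_, fun χ => ⟨χ.isSimple_toHModule, HModule.inBlock_toHModule χ⟩,
    fun χ χ' h V => ?_, fun χ χ' h V V' hV hV' f hf => ?_,
    fun V _ => V.existsUnique_isBlockDecomposition⟩
  · induction e using Quot.ind with
    | mk X =>
      refine Quot.sound (HModule.Extension.rel_split_of_isCoprime ?_ X)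
      rw [HCharacter.annihilator_toHModule_eq_maximal,
        HCharacter.annihilator_toHModule_eq_maximal]
      rw [← HCharacter.maximal_eq_iff] at h
      -- Non-conjugate characters have distinct maximal ideals as annihilators, and these are
      -- coprime.
      exact MaximalSpectrum.isCoprime_of_ne (Ne.symm h)
  · rw [HModule.inBlock_iff, HModule.inBlock_iff, (HCharacter.maximal_eq_iff χ χ').2 h]
  · exact HModule.eq_zero_of_inBlock (mt (HCharacter.maximal_eq_iff χ χ').1 h) hV hV' hf
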